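/- Let $M\subset\mathbb{R}^D$ be a smooth embedded $d$-dimensional submanifold (not necessarily closed or compact) with the metric induced from $\mathbb{R}^D$, let $\nabla^M$ be its Levi-Civita connection, and let $\nu$ be its normal bundle. For tangent vector fields, $\mathbf{II}(X,Y)=(D_XY)^{\perp}\in\nu$ denotes the second fundamental form, where $D$ is the flat connection of $\mathbb{R}^D$ and $(\cdot)^\perp$ is the orthogonal projection onto $\nu$; so $\nabla^M_XY$ is the tangential part of $D_XY$. Let $\nabla^{\perp}_XN=(D_XN)^{\perp}$ be the normal connection on $\nu$, and let $\nabla^M\mathbf{II}$ be the induced covariant derivative \[ (\nabla^M_X\mathbf{II})(Y,Z)=\nabla^{\perp}_X\bigl(\mathbf{II}(Y,Z)\bigr)-\mathbf{II}(\nabla^M_XY,Z)-\mathbf{II}(Y,\nabla^M_XZ). \] For a linear map $A:T_pM\to\nu_p$ let $\|A\|_{\mathrm{HS}}=\bigl(\sum_{i=1}^d\|A e_i\|^2\bigr)^{1/2}$ be the Hilbert-Schmidt norm, where $(e_i)$ is any orthonormal basis of $T_pM$. Let $J\subset\mathbb{R}$ be an interval with more than one point, and let $\gamma:J\to M$ be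 a smooth unit-speed geodesic of $M$ with velocity $v(t)=\gamma'(t)$. Suppose that for every $t\in J$ the linear map $\mathbf{II}_{\gamma(t)}(v(t),\cdot):T_{\gamma(t)}M\to\nu_{\gamma(t)}$ is not zero. Then the function $t\mapsto\log\|\mathbf{II}_{\gamma(t)}(v(t),\cdot)\|_{\mathrm{HS}}$ is differentiable on $J$, and for every $t\in J$ \[ \left|\frac{d}{dt}\log\|\mathbf{II}_{\gamma(t)}(v(t),\cdot)\|_{\mathrm{HS}}\right| \le \frac{\bigl\|(\nabla^M_{v(t)}\mathbf{II})(v(t),\cdot)\bigr\|_{\mathrm{HS}}}{\bigl\|\mathbf{II}_{\gamma(t)}(v(t),\cdot)\bigr\|_{\mathrm{HS}}}. \] (Derivatives at end points of $J$ that belong to $J$ are one-sided.) -/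

import Mathlib

open Set Filter Topology
open scoped ContDiff

noncomputable section

namespace EuclideanSubmanifold

/-- The Euclidean space `ℝ^D`. -/
abbrev Euc (D : ℕ) : Type := EuclideanSpace ℝ (Fin D)

/-- `M ⊆ ℝ^D` is a smooth embedded `d`-dimensional submanifold (without boundary, not necessarily
closed or compact): around each of its points there is a smooth slice chart of `ℝ^D`, that is, a
diffeomorphism `φ` between open subsets of `ℝ^D` that carries `M` to a `d`-dimensional linear
subspace. -/
def IsSmoothSubmanifold {D : ℕ} (d : ℕ) (M : Set (Euc D)) : Prop :=
  ∀ p ∈ M, ∃ (φ : OpenPartialHomeomorph (Euc D) (Euc D)) (W : Submodule ℝ (Euc D)),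
    p ∈ φ.source ∧
    ContDiffOn ℝ ∞ φ φ.source ∧
    ContDiffOn ℝ ∞ φ.symm φ.target ∧
    Module.finrank ℝ W = d ∧
    ∀ q ∈ φ.source, q ∈ M ↔ φ q ∈ W

/-- The tangent space `T_pM`, as a linear subspace of `ℝ^D`: it consists of the velocities at `p`
of the smooth curves in `M` through `p`. (For a submanifold these velocities already form a
linear subspace, and the span adds nothing.) -/
def tangentSpace {D : ℕ} (M : Set (Euc D)) (p : Euc D) : Submodule ℝ (Euc D) :=
  Submodule.span ℝ
    {v | ∃ c : ℝ → Euc D, ContDiffAt ℝ ∞ c 0 ∧ c 0 = p ∧ (∀ᶠ t in 𝓝 (0 : ℝ), c t ∈ M) ∧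
      deriv c 0 = v}

/-- The orthogonal projection `ℝ^D → T_pM ⊆ ℝ^D`. -/
def tangentProj {D : ℕ} (M : Set (Euc D)) (p : Euc D) : Euc D →L[ℝ] Euc D :=
  (tangentSpace M p).starProjection

/-- The orthogonal projection `(·)^⊥ : ℝ^D → ν_p ⊆ ℝ^D` onto the normal space of `M` at `p`. -/
def normalProj {D : ℕ} (M : Set (Euc D)) (p : Euc D) : Euc D →L[ℝ] Euc D :=
  (tangentSpace M p)ᗮ.starProjection

/-- The flat (ambient Levi-Civita) derivative `D_X Y` at `p ∈ M`, for a vector field `X` tangent to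
`M` and a smooth `ℝ^D`-valued function `Y` on `M`. It uses the values of `Y` on `M` only, and it
is the derivative at `p`, in the tangent direction `X p`, of any smooth extension of `Y`. -/
def ambientDeriv {D : ℕ} (M : Set (Euc D)) (X Y : Euc D → Euc D) (p : Euc D) : Euc D :=
  fderivWithin ℝ Y M p (X p)

/-- The Levi-Civita connection `∇^M_X Y = (D_X Y)^⊤` of `M` with the induced metric, for tangent
vector fields `X`, `Y` on `M`. -/
def connection {D : ℕ} (M : Set (Euc D)) (X Y : Euc D → Euc D) (p : Euc D) : Euc D :=
  tangentProj M p (ambientDeriv M X Y p)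

/-! The next facts confirm the definitions above: `tangentSpace` is the kernel of the derivative of
a local defining map, `ambientDeriv` does not depend on the choice made by `fderivWithin`, and
`connection` is metric and torsion-free, hence the Levi-Civita connection of `M`. -/

/-- The tangent spaces of `M` are locally the kernels of the derivative of a smooth map. -/
theorem exists_definingMap {D d : ℕ} {M : Set (Euc D)} (hM : IsSmoothSubmanifold d M)
    {p : Euc D} (hp : p ∈ M) :
    ∃ (U : Set (Euc D)) (g : Euc D → Euc D), IsOpen U ∧ p ∈ U ∧ ContDiffOn ℝ ∞ g U ∧
      ∀ q ∈ M ∩ U, ∀ v, v ∈ tangentSpace M q ↔ fderiv ℝ g q v = 0 := by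
  obtain ⟨φ, W, hpφ, hφ, hφs, -, hMW⟩ := hM p hp
  set π : Euc D →L[ℝ] Euc D := Wᗮ.starProjection with hπ
  have hπ0 : ∀ x, π x = 0 ↔ x ∈ W := by
    intro x
    rw [hπ, Submodule.starProjection_apply_eq_zero_iff, Submodule.orthogonal_orthogonal]
  refine ⟨φ.source, fun q => π (φ q), φ.open_source, hpφ, π.contDiff.comp_contDiffOn hφ, ?_⟩
  rintro q ⟨hqM, hq⟩ v
  have hdφ : DifferentiableAt ℝ φ q :=
    (hφ.contDiffAt (φ.open_source.mem_nhds hq)).differentiableAt (by simp)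
  have hdφs : ContDiffAt ℝ ∞ φ.symm (φ q) :=
    hφs.contDiffAt (φ.open_target.mem_nhds (φ.map_source hq))
  have hfd : fderiv ℝ (fun q => π (φ q)) q = π.comp (fderiv ℝ φ q) :=
    (π.hasFDerivAt.comp q hdφ.hasFDerivAt).fderiv
  constructor
  · intro hv
    have hle : tangentSpace M q ≤
        LinearMap.ker ((fderiv ℝ (fun q => π (φ q)) q : Euc D →L[ℝ] Euc D) : Euc D →ₗ[ℝ] Euc D) := by
      refine Submodule.span_le.2 ?_
      rintro w ⟨c, hc, hc0, hcM, rfl⟩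
      have hcd : HasDerivAt c (deriv c 0) 0 := (hc.differentiableAt (by simp)).hasDerivAt
      have hgd : DifferentiableAt ℝ (fun q => π (φ q)) (c 0) := by
        rw [hc0]; exact π.differentiableAt.comp q hdφ
      have h1 := hgd.hasFDerivAt.comp_hasDerivAt (0 : ℝ) hcd
      have hev : (fun q => π (φ q)) ∘ c =ᶠ[𝓝 0] fun _ => (0 : Euc D) := by
        have hs : ∀ᶠ t in 𝓝 (0 : ℝ), c t ∈ φ.source :=
          hc.continuousAt.eventually_mem (by rw [hc0]; exact φ.open_source.mem_nhds hq)
        filter_upwards [hcM, hs] with t ht hts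
        exact (hπ0 _).2 ((hMW _ hts).1 ht)
      have h2 := h1.unique ((hasDerivAt_const (0 : ℝ) (0 : Euc D)).congr_of_eventuallyEq hev)
      rw [hc0] at h2
      exact h2
    exact hle hv
  · intro hv
    rw [hfd] at hv
    have hw : fderiv ℝ φ q v ∈ W := (hπ0 _).1 hv
    refine Submodule.subset_span ⟨fun t => φ.symm (φ q + t • fderiv ℝ φ q v), ?_, ?_, ?_, ?_⟩
    · refine ContDiffAt.comp (0 : ℝ) (g := φ.symm) (by simpa using hdφs) ?_
      exact contDiffAt_const.add (contDiffAt_id.smul contDiffAt_const)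
    · simp [φ.left_inv hq]
    · have hcont : ContinuousAt (fun t : ℝ => φ q + t • fderiv ℝ φ q v) 0 := by fun_prop
      have : ∀ᶠ t in 𝓝 (0 : ℝ), φ q + t • fderiv ℝ φ q v ∈ φ.target :=
        hcont.eventually_mem (by simpa using φ.open_target.mem_nhds (φ.map_source hq))
      filter_upwards [this] with t ht
      refine (hMW _ (φ.map_target ht)).2 ?_
      rw [φ.right_inv ht]
      exact W.add_mem ((hMW _ hq).1 hqM) (W.smul_mem _ hw)
    · have h1 : HasDerivAt (fun t : ℝ => φ q + t • fderiv ℝ φ q v) (fderiv ℝ φ q v) 0 := by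
        simpa using ((hasDerivAt_id (0 : ℝ)).smul_const (fderiv ℝ φ q v)).const_add (φ q)
      have h2 : HasFDerivAt φ.symm (fderiv ℝ φ.symm (φ q)) (φ q + (0 : ℝ) • fderiv ℝ φ q v) := by
        simpa using (hdφs.differentiableAt (by simp)).hasFDerivAt
      refine (h2.comp_hasDerivAt (0 : ℝ) h1).deriv.trans ?_
      have h3 : HasFDerivAt (φ.symm ∘ φ) ((fderiv ℝ φ.symm (φ q)).comp (fderiv ℝ φ q)) q :=
        (hdφs.differentiableAt (by simp)).hasFDerivAt.comp q hdφ.hasFDerivAt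
      have h4 : φ.symm ∘ φ =ᶠ[𝓝 q] id := by
        filter_upwards [φ.open_source.mem_nhds hq] with x hx using φ.left_inv hx
      have h5 := h3.unique ((hasFDerivAt_id q).congr_of_eventuallyEq h4)
      simpa using congrArg (fun L : Euc D →L[ℝ] Euc D => L v) h5

/-- Any two derivatives within `M` agree on tangent vectors. -/
theorem fderivWithin_apply_eq {D : ℕ} {M : Set (Euc D)} {p v : Euc D}
    {G : Type*} [NormedAddCommGroup G] [NormedSpace ℝ G] {F : Euc D → G} {A B : Euc D →L[ℝ] G} (hA : HasFDerivWithinAt F A M p) (hB : HasFDerivWithinAt F B M p)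
    (hv : v ∈ tangentSpace M p) : A v = B v := by
  have hle : tangentSpace M p ≤ LinearMap.ker ((A - B : Euc D →L[ℝ] G) : Euc D →ₗ[ℝ] G) := by
    refine Submodule.span_le.2 ?_
    rintro w ⟨c, hc, hc0, hcM, rfl⟩
    have hcd : HasDerivAt c (deriv c 0) 0 := (hc.differentiableAt (by simp)).hasDerivAt
    subst hc0
    have hm : MapsTo c (c ⁻¹' M) M := fun _ h => h
    have hA1 := (hA.comp_hasDerivWithinAt (0 : ℝ) hcd.hasDerivWithinAt hm).hasDerivAt hcM
    have hB1 := (hB.comp_hasDerivWithinAt (0 : ℝ) hcd.hasDerivWithinAt hm).hasDerivAt hcM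
    have := hA1.unique hB1
    simpa [sub_eq_zero] using this
  have := hle hv
  simpa [sub_eq_zero] using this

/-- The connection is compatible with the induced metric. -/
theorem connection_metric {D : ℕ} {M : Set (Euc D)} {p : Euc D} (X Y Z : Euc D → Euc D)
    (hp : p ∈ M) (hX : X p ∈ tangentSpace M p)
    (hY : ∀ q ∈ M, Y q ∈ tangentSpace M q) (hZ : ∀ q ∈ M, Z q ∈ tangentSpace M q)
    (hYd : DifferentiableWithinAt ℝ Y M p) (hZd : DifferentiableWithinAt ℝ Z M p) :
    fderivWithin ℝ (fun q => inner ℝ (Y q) (Z q)) M p (X p) =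
      inner ℝ (connection M X Y p) (Z p) + inner ℝ (Y p) (connection M X Z p) := by
  have h1 := hYd.hasFDerivWithinAt.inner ℝ hZd.hasFDerivWithinAt
  have h2 := (hYd.inner ℝ hZd).hasFDerivWithinAt
  rw [fderivWithin_apply_eq h2 h1 hX]
  have e1 : inner ℝ (connection M X Y p) (Z p) = inner ℝ (ambientDeriv M X Y p) (Z p) := by
    rw [connection, tangentProj, Submodule.inner_starProjection_left_eq_right,
      Submodule.starProjection_eq_self_iff.2 (hZ p hp)]
  have e2 : inner ℝ (Y p) (connection M X Z p) = inner ℝ (Y p) (ambientDeriv M X Z p) := by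
    rw [connection, tangentProj, ← Submodule.inner_starProjection_left_eq_right,
      Submodule.starProjection_eq_self_iff.2 (hY p hp)]
  rw [e1, e2]
  simp [ambientDeriv, add_comm]

/-- The connection is torsion-free: for tangent vector fields, `D_X Y - D_Y X` (the Lie bracket) is
tangent to `M`, and it equals `∇^M_X Y - ∇^M_Y X`. -/
theorem connection_torsionFree {D d : ℕ} {M : Set (Euc D)} (hM : IsSmoothSubmanifold d M)
    {p : Euc D} (X Y : Euc D → Euc D) (hp : p ∈ M)
    (hX : ∀ q ∈ M, X q ∈ tangentSpace M q) (hY : ∀ q ∈ M, Y q ∈ tangentSpace M q)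
    (hXd : DifferentiableWithinAt ℝ X M p) (hYd : DifferentiableWithinAt ℝ Y M p) :
    connection M X Y p - connection M Y X p = ambientDeriv M X Y p - ambientDeriv M Y X p := by
  obtain ⟨U, g, hU, hpU, hg, hT⟩ := exists_definingMap hM hp
  have hgp : ContDiffAt ℝ ∞ g p := hg.contDiffAt (hU.mem_nhds hpU)
  have hgp2 : ContDiffAt ℝ 2 g p := contDiffAt_infty.1 hgp 2
  have hg2 : DifferentiableAt ℝ (fderiv ℝ g) p :=
    (hgp2.fderiv_right (m := 1) (by norm_num)).differentiableAt (by simp)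
  have key : ∀ A B : Euc D → Euc D, (∀ q ∈ M, A q ∈ tangentSpace M q) →
      (∀ q ∈ M, B q ∈ tangentSpace M q) → DifferentiableWithinAt ℝ B M p →
      fderiv ℝ (fderiv ℝ g) p (A p) (B p) + fderiv ℝ g p (ambientDeriv M A B p) = 0 := by
    intro A B hA hB hBd
    have h1 := hg2.hasFDerivAt.hasFDerivWithinAt (s := M) |>.clm_apply hBd.hasFDerivWithinAt
    have h2 : HasFDerivWithinAt (fun q => fderiv ℝ g q (B q)) (0 : Euc D →L[ℝ] Euc D) M p := by
      refine (hasFDerivWithinAt_const (0 : Euc D) p M).congr_of_eventuallyEq ?_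
        ((hT p ⟨hp, hpU⟩ _).1 (hB p hp))
      filter_upwards [self_mem_nhdsWithin, mem_nhdsWithin_of_mem_nhds (hU.mem_nhds hpU)]
        with q hq hqU
      exact (hT q ⟨hq, hqU⟩ _).1 (hB q hq)
    have h3 := fderivWithin_apply_eq h1 h2 (hA p hp)
    simpa [ambientDeriv, add_comm] using h3
  have hsymm : fderiv ℝ (fderiv ℝ g) p (X p) (Y p) = fderiv ℝ (fderiv ℝ g) p (Y p) (X p) :=
    (hgp2.isSymmSndFDerivAt (by simp)) (X p) (Y p)
  have hmem : ambientDeriv M X Y p - ambientDeriv M Y X p ∈ tangentSpace M p := by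
    rw [hT p ⟨hp, hpU⟩, map_sub]
    have k1 := key X Y hX hY hYd
    have k2 := key Y X hY hX hXd
    rw [hsymm] at k1
    exact sub_eq_zero.2 (add_left_cancel (k1.trans k2.symm))
  rw [connection, connection, ← map_sub, tangentProj]
  exact Submodule.starProjection_eq_self_iff.2 hmem

/-- The normal connection `∇^⊥_X N = (D_X N)^⊥`, for a tangent vector field `X` and a normal vector
field `N` on `M`. -/
def normalConnection {D : ℕ} (M : Set (Euc D)) (X N : Euc D → Euc D) (p : Euc D) : Euc D :=
  normalProj M p (ambientDeriv M X N p)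

/-- The second fundamental form `II(X, Y) = (D_X Y)^⊥` on tangent vector fields `X`, `Y`. -/
def secondFundField {D : ℕ} (M : Set (Euc D)) (X Y : Euc D → Euc D) (p : Euc D) : Euc D :=
  normalProj M p (ambientDeriv M X Y p)

/-- The covariant derivative of the second fundamental form on tangent vector fields:
`(∇_X II)(Y, Z) = ∇^⊥_X (II(Y, Z)) - II(∇^M_X Y, Z) - II(Y, ∇^M_X Z)`. -/
def covDerivSecondFundField {D : ℕ} (M : Set (Euc D)) (X Y Z : Euc D → Euc D) (p : Euc D) :
    Euc D :=
  normalConnection M X (secondFundField M Y Z) p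
    - secondFundField M (connection M X Y) Z p
    - secondFundField M Y (connection M X Z) p

/-- An extension of `v ∈ T_pM` to a smooth tangent vector field on `M`: `q ↦` the orthogonal
projection of `v` to `T_qM`. -/
def tangentExtension {D : ℕ} (M : Set (Euc D)) (v : Euc D) : Euc D → Euc D :=
  fun q => tangentProj M q v

/-- The second fundamental form as a tensor: `II_p(v, w)` for `v w ∈ T_pM`. The value on vector
fields at `p` depends only on the values of the fields at `p`, so `v` and `w` may be extended to
tangent vector fields in any way. -/
def secondFund {D : ℕ} (M : Set (Euc D)) (p v w : Euc D) : Euc D :=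
  secondFundField M (tangentExtension M v) (tangentExtension M w) p

/-- The covariant derivative of the second fundamental form as a tensor: `(∇_u II)_p(v, w)` for
`u v w ∈ T_pM`. -/
def covDerivSecondFund {D : ℕ} (M : Set (Euc D)) (p u v w : Euc D) : Euc D :=
  covDerivSecondFundField M (tangentExtension M u) (tangentExtension M v)
    (tangentExtension M w) p

/-- The Hilbert-Schmidt norm of a linear operator `A : T → ℝ^D` on a linear subspace `T`:
the square root of `∑ i, ‖A (e i)‖ ^ 2` for an orthonormal basis `e` of `T`. -/
def hsNorm {D : ℕ} (T : Submodule ℝ (Euc D)) (A : Euc D → Euc D) : ℝ :=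
  √(∑ i, ‖A (stdOrthonormalBasis ℝ T i : Euc D)‖ ^ 2)

/-- The covariant derivative in `M` of a vector field `V` along the curve `γ : J → M`, where `J` is
an interval (one-sided derivatives are taken at end points that belong to `J`). -/
def covDerivAlong {D : ℕ} (M : Set (Euc D)) (J : Set ℝ) (γ V : ℝ → Euc D) (t : ℝ) : Euc D :=
  tangentProj M (γ t) (derivWithin V J t)

/-- `γ : J → M` is a unit-speed geodesic of `M`, where `J` is an interval of positive length. -/
structure IsUnitSpeedGeodesic {D : ℕ} (M : Set (Euc D)) (J : Set ℝ) (γ : ℝ → Euc D) : Prop where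
  ordConnected : J.OrdConnected
  nontrivial : J.Nontrivial
  mapsTo : MapsTo γ J M
  smooth : ContDiffOn ℝ ∞ γ J
  unitSpeed : ∀ t ∈ J, ‖derivWithin γ J t‖ = 1
  geodesic : ∀ t ∈ J, covDerivAlong M J γ (derivWithin γ J) t = 0

end EuclideanSubmanifold

end

/-! Write `P` for the field of orthogonal projections onto the tangent spaces. Near each point of
`M` it extends to a smooth operator-valued map `R` on an open set of the ambient space
(`IsSmoothSubmanifold.exists_isProjExtension`), and all the geometry becomes calculus with `R`.
Differentiating `R² = R` along `M` shows that `D_v R` exchanges tangent and normal vectors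
(`IsProjExtension.fderiv_apply`). Hence `II(v, ·)` is the restriction to the tangent space of `A =
(1 - R) D_v R`, an operator on the whole of `ℝ^D` that vanishes on normal vectors and has normal
values.

Along the geodesic, the equation `γ'' = (D_{γ'} R) γ'` makes the normal part of `A'` on tangent
vectors equal to `(∇_{γ'} II)(γ', ·)` (`IsUnitSpeedGeodesic.exists_hasDerivWithinAt_shapeOp`). Since
`A` kills normal vectors, `‖A‖²_HS` can be computed in a fixed basis of `ℝ^D`, so no moving frame
has to be differentiated. Its derivative is `2⟨A, A'⟩`; because `A` has normal values and kills
normal vectors, this is `2⟨II(γ', ·), (∇_{γ'} II)(γ', ·)⟩` on the tangent space. Cauchy-Schwarz and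
division by `2‖A‖²` give the bound. -/

namespace EuclideanSubmanifold

variable {D d : ℕ} {M : Set (Euc D)}

/-! ### Slice charts and tangent spaces -/

/-- The data of a smooth slice chart of `M`, as in `IsSmoothSubmanifold`. -/
structure IsSliceChart (M : Set (Euc D)) (φ : OpenPartialHomeomorph (Euc D) (Euc D))
    (W : Submodule ℝ (Euc D)) : Prop where
  smooth : ContDiffOn ℝ ∞ φ φ.source
  smooth_symm : ContDiffOn ℝ ∞ φ.symm φ.target
  mem_iff : ∀ q ∈ φ.source, q ∈ M ↔ φ q ∈ W

namespace IsSliceChart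

variable {φ : OpenPartialHomeomorph (Euc D) (Euc D)} {W : Submodule ℝ (Euc D)} {q : Euc D}

theorem hasFDerivAt (h : IsSliceChart M φ W) (hq : q ∈ φ.source) :
    HasFDerivAt φ (fderiv ℝ φ q) q :=
  ((h.smooth.contDiffAt (φ.open_source.mem_nhds hq)).differentiableAt (by simp)).hasFDerivAt

theorem hasFDerivAt_symm (h : IsSliceChart M φ W) (hq : q ∈ φ.source) :
    HasFDerivAt φ.symm (fderiv ℝ φ.symm (φ q)) (φ q) :=
  ((h.smooth_symm.contDiffAt (φ.open_target.mem_nhds (φ.map_source hq))).differentiableAt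
    (by simp)).hasFDerivAt

theorem fderiv_symm_fderiv (h : IsSliceChart M φ W) (hq : q ∈ φ.source) (v : Euc D) :
    fderiv ℝ φ.symm (φ q) (fderiv ℝ φ q v) = v := by
  have h4 : φ.symm ∘ φ =ᶠ[𝓝 q] id := by
    filter_upwards [φ.open_source.mem_nhds hq] with x hx using φ.left_inv hx
  have h5 := ((h.hasFDerivAt_symm hq).comp q (h.hasFDerivAt hq)).unique
    ((hasFDerivAt_id q).congr_of_eventuallyEq h4)
  simpa using congrArg (fun L : Euc D →L[ℝ] Euc D => L v) h5

theorem fderiv_fderiv_symm (h : IsSliceChart M φ W) (hq : q ∈ φ.source) (v : Euc D) :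
    fderiv ℝ φ q (fderiv ℝ φ.symm (φ q) v) = v := by
  have h4 : φ ∘ φ.symm =ᶠ[𝓝 (φ q)] id := by
    filter_upwards [φ.open_target.mem_nhds (φ.map_source hq)] with x hx using φ.right_inv hx
  have h1 : HasFDerivAt φ (fderiv ℝ φ q) (φ.symm (φ q)) := by
    rw [φ.left_inv hq]; exact h.hasFDerivAt hq
  have h5 := (h1.comp (φ q) (h.hasFDerivAt_symm hq)).unique
    ((hasFDerivAt_id (φ q)).congr_of_eventuallyEq h4)
  simpa using congrArg (fun L : Euc D →L[ℝ] Euc D => L v) h5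

/-- A slice chart carries the velocities of curves in `M` (one-sided ones included) to `W`. -/
theorem fderiv_velocity_mem (h : IsSliceChart M φ W) {c : ℝ → Euc D} {v : Euc D} {s : Set ℝ}
    {t : ℝ} (hc : HasDerivWithinAt c v s t) (hs : UniqueDiffWithinAt ℝ s t) (hts : t ∈ s)
    (hcM : MapsTo c s M) (hct : c t ∈ φ.source) : fderiv ℝ φ (c t) v ∈ W := by
  -- `π` vanishes exactly on `W`, so `π ∘ φ` is a local defining map of `M`; it is zero along `c`,
  -- hence so is its derivative.
  set π : Euc D →L[ℝ] Euc D := Wᗮ.starProjection with hπ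
  have hπ0 : ∀ x, π x = 0 ↔ x ∈ W := by
    intro x
    rw [hπ, Submodule.starProjection_apply_eq_zero_iff, Submodule.orthogonal_orthogonal]
  have h1 : HasDerivWithinAt (fun r => π (φ (c r))) (π (fderiv ℝ φ (c t) v)) s t :=
    (π.hasFDerivAt.comp (c t) (h.hasFDerivAt hct)).comp_hasDerivWithinAt t hc
  have h2 : HasDerivWithinAt (fun r => π (φ (c r))) 0 s t := by
    refine (hasDerivWithinAt_const t s (0 : Euc D)).congr_of_eventuallyEq ?_
      ((hπ0 _).2 ((h.mem_iff _ hct).1 (hcM hts)))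
    filter_upwards [self_mem_nhdsWithin,
      hc.continuousWithinAt.eventually_mem (φ.open_source.mem_nhds hct)] with r hr hrs
    exact (hπ0 _).2 ((h.mem_iff _ hrs).1 (hcM hr))
  exact (hπ0 _).1 (hs.eq_deriv s h1 h2)

theorem mem_tangentSpace_iff (h : IsSliceChart M φ W) (hq : q ∈ φ.source) (hqM : q ∈ M)
    (v : Euc D) : v ∈ tangentSpace M q ↔ fderiv ℝ φ q v ∈ W := by
  constructor
  · intro hv
    have hle : tangentSpace M q ≤
        W.comap ((fderiv ℝ φ q : Euc D →L[ℝ] Euc D) : Euc D →ₗ[ℝ] Euc D) := by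
      refine Submodule.span_le.2 ?_
      rintro w ⟨c, hc, rfl, hcM, rfl⟩
      have hcd : HasDerivAt c (deriv c 0) 0 := (hc.differentiableAt (by simp)).hasDerivAt
      exact h.fderiv_velocity_mem (s := c ⁻¹' M) hcd.hasDerivWithinAt
        (uniqueDiffWithinAt_of_mem_nhds hcM) hqM (fun _ h => h) hq
    exact hle hv
  · intro hw
    -- The curve is a straight segment of `W + φ q = W` in the chart, pulled back to `M`.
    refine Submodule.subset_span ⟨fun t => φ.symm (φ q + t • fderiv ℝ φ q v), ?_, ?_, ?_, ?_⟩
    · refine ContDiffAt.comp (0 : ℝ) (g := φ.symm) ?_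
        (contDiffAt_const.add (contDiffAt_id.smul contDiffAt_const))
      simpa using h.smooth_symm.contDiffAt (φ.open_target.mem_nhds (φ.map_source hq))
    · simp [φ.left_inv hq]
    · have hcont : ContinuousAt (fun t : ℝ => φ q + t • fderiv ℝ φ q v) 0 := by fun_prop
      have : ∀ᶠ t in 𝓝 (0 : ℝ), φ q + t • fderiv ℝ φ q v ∈ φ.target :=
        hcont.eventually_mem (by simpa using φ.open_target.mem_nhds (φ.map_source hq))
      filter_upwards [this] with t ht
      refine (h.mem_iff _ (φ.map_target ht)).2 ?_
      rw [φ.right_inv ht]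
      exact W.add_mem ((h.mem_iff _ hq).1 hqM) (W.smul_mem _ hw)
    · have h1 : HasDerivAt (fun t : ℝ => φ q + t • fderiv ℝ φ q v) (fderiv ℝ φ q v) 0 := by
        simpa using ((hasDerivAt_id (0 : ℝ)).smul_const (fderiv ℝ φ q v)).const_add (φ q)
      have h2 : HasFDerivAt φ.symm (fderiv ℝ φ.symm (φ q)) (φ q + (0 : ℝ) • fderiv ℝ φ q v) := by
        simpa using h.hasFDerivAt_symm hq
      exact (h2.comp_hasDerivAt (0 : ℝ) h1).deriv.trans (h.fderiv_symm_fderiv hq v)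

end IsSliceChart

theorem IsSmoothSubmanifold.exists_isSliceChart (hM : IsSmoothSubmanifold d M) {p : Euc D}
    (hp : p ∈ M) : ∃ φ W, p ∈ φ.source ∧ IsSliceChart M φ W := by
  obtain ⟨φ, W, hpφ, hφ, hφs, -, hMW⟩ := hM p hp
  exact ⟨φ, W, hpφ, hφ, hφs, hMW⟩

/-- Velocities of curves in `M`, one-sided ones included, are tangent to `M`. -/
theorem IsSmoothSubmanifold.velocity_mem_tangentSpace (hM : IsSmoothSubmanifold d M)
    {c : ℝ → Euc D} {v : Euc D} {s : Set ℝ} {t : ℝ} (hc : HasDerivWithinAt c v s t)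
    (hs : UniqueDiffWithinAt ℝ s t) (hts : t ∈ s) (hcM : MapsTo c s M) :
    v ∈ tangentSpace M (c t) := by
  obtain ⟨φ, W, hpφ, h⟩ := hM.exists_isSliceChart (hcM hts)
  exact (h.mem_tangentSpace_iff hpφ (hcM hts) v).2 (h.fderiv_velocity_mem hc hs hts hcM hpφ)

/-! ### Orthogonal projection onto the range of an injective operator -/

section Projection

variable {E F : Type*} [NormedAddCommGroup E] [InnerProductSpace ℝ E]
  [NormedAddCommGroup F] [InnerProductSpace ℝ F]

theorem contDiff_adjoint [CompleteSpace E] [CompleteSpace F] {n : WithTop ℕ∞} :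
    ContDiff ℝ n (fun A : E →L[ℝ] F => ContinuousLinearMap.adjoint A) := by
  refine IsBoundedLinearMap.contDiff (IsLinearMap.with_bound ⟨fun A B => ?_, fun r A => ?_⟩ 1 ?_)
  · simp
  · simp
  · intro A; simp

/-- The Gram operator `A†A` of an injective operator is invertible. -/
theorem isInvertible_adjoint_comp_self [FiniteDimensional ℝ E] [CompleteSpace E] [CompleteSpace F]
    (A : E →L[ℝ] F) (hA : Function.Injective A) :
    ((ContinuousLinearMap.adjoint A).comp A).IsInvertible := by
  set G := (ContinuousLinearMap.adjoint A).comp A with hG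
  have hinj : Function.Injective (G : E →ₗ[ℝ] E) := by
    -- `⟨A†A x, x⟩ = ‖A x‖²`, so the kernel of the Gram operator is that of `A`.
    refine (injective_iff_map_eq_zero _).2 fun x hx => hA ?_
    have : inner ℝ (G x) x = 0 := by
      have : G x = 0 := hx
      rw [this, inner_zero_left]
    rw [hG, ContinuousLinearMap.comp_apply, ContinuousLinearMap.adjoint_inner_left,
      inner_self_eq_zero] at this
    rw [this, map_zero]
  refine ⟨(LinearEquiv.ofInjectiveEndo _ hinj).toContinuousLinearEquiv, ?_⟩
  ext x
  rfl

/-- The orthogonal projection onto the range of an injective operator `A` is `A (A†A)⁻¹ A†`. -/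
theorem starProjection_eq_of_injective [FiniteDimensional ℝ E] [CompleteSpace E] [CompleteSpace F]
    (A : E →L[ℝ] F) (hA : Function.Injective A) (T : Submodule ℝ F) [T.HasOrthogonalProjection]
    (hT : ∀ v, v ∈ T ↔ ∃ w, A w = v) :
    T.starProjection = A.comp ((((ContinuousLinearMap.adjoint A).comp A).inverse).comp
      (ContinuousLinearMap.adjoint A)) := by
  ext x
  refine Submodule.eq_starProjection_of_mem_orthogonal ((hT _).2 ⟨_, rfl⟩) ?_
  rw [Submodule.mem_orthogonal]
  intro u hu
  obtain ⟨w, rfl⟩ := (hT u).1 hu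
  rw [← ContinuousLinearMap.adjoint_inner_right, map_sub]
  obtain ⟨e, he⟩ := isInvertible_adjoint_comp_self A hA
  have key : ContinuousLinearMap.adjoint A ((A.comp ((((ContinuousLinearMap.adjoint A).comp
      A).inverse).comp (ContinuousLinearMap.adjoint A))) x) = ContinuousLinearMap.adjoint A x := by
    change ((ContinuousLinearMap.adjoint A).comp A)
      ((((ContinuousLinearMap.adjoint A).comp A).inverse) (ContinuousLinearMap.adjoint A x)) = _
    rw [← he, ContinuousLinearMap.inverse_equiv]
    simp
  rw [key, sub_self, inner_zero_right]

end Projection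

/-! ### Smooth extension of the tangent projections; `II` and `∇II` in terms of it -/

/-- `R` is a smooth extension to the open set `U` of the projections onto the tangent spaces. -/
structure IsProjExtension (M : Set (Euc D)) (U : Set (Euc D)) (R : Euc D → Euc D →L[ℝ] Euc D) :
    Prop where
  isOpen : IsOpen U
  smooth : ContDiffOn ℝ ∞ R U
  eq_tangentProj : ∀ q ∈ M ∩ U, R q = tangentProj M q

/-- The differential of the inverse chart, restricted to `W`, is an injective operator `A q` that
depends smoothly on `q` and has range `T_qM` when `q ∈ M`. The formula `A (A†A)⁻¹ A†` makes sense on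
the whole chart domain and is smooth there because inversion is smooth at invertible operators. -/
theorem IsSmoothSubmanifold.exists_isProjExtension (hM : IsSmoothSubmanifold d M) {p : Euc D}
    (hp : p ∈ M) : ∃ U R, p ∈ U ∧ IsProjExtension M U R := by
  obtain ⟨φ, W, hpφ, h⟩ := hM.exists_isSliceChart hp
  let A : Euc D → W →L[ℝ] Euc D := fun q => (fderiv ℝ φ.symm (φ q)).comp W.subtypeL
  have hinj : ∀ q ∈ φ.source, Function.Injective (A q) := by
    intro q hq x y hxy
    have := congrArg (fderiv ℝ φ q) hxy
    simp only [A, ContinuousLinearMap.comp_apply, h.fderiv_fderiv_symm hq] at this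
    exact Subtype.ext this
  have hA : ContDiffOn ℝ ∞ A φ.source := by
    have h1 : ContDiffOn ℝ ∞ (fderiv ℝ φ.symm) φ.target :=
      h.smooth_symm.fderiv_of_isOpen φ.open_target (by simp)
    exact (h1.comp h.smooth φ.mapsTo).clm_comp contDiffOn_const
  have hA' : ContDiffOn ℝ ∞ (fun q => ContinuousLinearMap.adjoint (A q)) φ.source :=
    contDiff_adjoint.comp_contDiffOn hA
  refine ⟨φ.source, fun q => (A q).comp ((((ContinuousLinearMap.adjoint (A q)).comp
    (A q)).inverse).comp (ContinuousLinearMap.adjoint (A q))), hpφ, φ.open_source, ?_, ?_⟩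
  · refine hA.clm_comp (ContDiffOn.clm_comp ?_ hA')
    intro q hq
    exact ((isInvertible_adjoint_comp_self (A q) (hinj q hq)).contDiffAt_map_inverse).comp_contDiffWithinAt
      q ((hA'.clm_comp hA) q hq)
  · rintro q ⟨hqM, hq⟩
    refine (starProjection_eq_of_injective (A q) (hinj q hq) (tangentSpace M q) fun v => ?_).symm
    rw [h.mem_tangentSpace_iff hq hqM]
    constructor
    · exact fun hv => ⟨⟨_, hv⟩, h.fderiv_symm_fderiv hq v⟩
    · rintro ⟨w, rfl⟩
      simp only [A, ContinuousLinearMap.comp_apply, h.fderiv_fderiv_symm hq]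
      exact w.2

namespace IsProjExtension

variable {U : Set (Euc D)} {R : Euc D → Euc D →L[ℝ] Euc D} {q u v w : Euc D}

theorem apply_mem (h : IsProjExtension M U R) (hq : q ∈ M ∩ U) (x : Euc D) :
    R q x ∈ tangentSpace M q := by
  rw [h.eq_tangentProj q hq]
  exact Submodule.starProjection_apply_mem _ _

theorem apply_eq_self (h : IsProjExtension M U R) (hq : q ∈ M ∩ U)
    (hv : v ∈ tangentSpace M q) : R q v = v := by
  rw [h.eq_tangentProj q hq]
  exact Submodule.starProjection_eq_self_iff.2 hv

theorem apply_apply (h : IsProjExtension M U R) (hq : q ∈ M ∩ U) (x : Euc D) :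
    R q (R q x) = R q x :=
  h.apply_eq_self hq (h.apply_mem hq x)

theorem normalProj_eq (h : IsProjExtension M U R) (hq : q ∈ M ∩ U) (x : Euc D) :
    normalProj M q x = x - R q x := by
  rw [normalProj, Submodule.starProjection_orthogonal_val, h.eq_tangentProj q hq, tangentProj]

theorem hasFDerivAt (h : IsProjExtension M U R) (hq : q ∈ U) :
    HasFDerivAt R (fderiv ℝ R q) q :=
  ((h.smooth.contDiffAt (h.isOpen.mem_nhds hq)).differentiableAt (by simp)).hasFDerivAt

theorem hasFDerivAt_fderiv (h : IsProjExtension M U R) (hq : q ∈ U) :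
    HasFDerivAt (fderiv ℝ R) (fderiv ℝ (fderiv ℝ R) q) q :=
  (((h.smooth.fderiv_of_isOpen h.isOpen (m := ∞) (by simp)).contDiffAt
    (h.isOpen.mem_nhds hq)).differentiableAt (by simp)).hasFDerivAt

theorem eventually_mem (h : IsProjExtension M U R) (hq : q ∈ M ∩ U) :
    ∀ᶠ x in 𝓝[M] q, x ∈ M ∩ U := by
  filter_upwards [self_mem_nhdsWithin, mem_nhdsWithin_of_mem_nhds (h.isOpen.mem_nhds hq.2)]
    with x hx hxU using ⟨hx, hxU⟩

/-- The ambient derivative is computed by any extension of the differentiated field. -/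
theorem ambientDeriv_eq (h : IsProjExtension M U R) (hq : q ∈ M ∩ U) {X Y Z : Euc D → Euc D}
    {L : Euc D →L[ℝ] Euc D} (hX : X q ∈ tangentSpace M q) (hYZ : ∀ x ∈ M ∩ U, Y x = Z x)
    (hZ : HasFDerivAt Z L q) : ambientDeriv M X Y q = L (X q) := by
  have h1 : HasFDerivWithinAt Y L M q :=
    hZ.hasFDerivWithinAt.congr_of_eventuallyEq ((h.eventually_mem hq).mono hYZ) (hYZ q hq)
  exact fderivWithin_apply_eq h1.differentiableWithinAt.hasFDerivWithinAt h1 hX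

theorem hasFDerivAt_apply_const (h : IsProjExtension M U R) (hq : q ∈ U) (x : Euc D) :
    HasFDerivAt (fun y => R y x) ((fderiv ℝ R q).flip x) q := by
  simpa using (h.hasFDerivAt hq).clm_apply (hasFDerivAt_const x q)

/-- Differentiating `R² = R` along `M`. -/
theorem fderiv_apply (h : IsProjExtension M U R) (hq : q ∈ M ∩ U) (hu : u ∈ tangentSpace M q)
    (x : Euc D) : fderiv ℝ R q u x = fderiv ℝ R q u (R q x) + R q (fderiv ℝ R q u x) := by
  have h0 : HasFDerivAt (fun y => R y x) ((fderiv ℝ R q).flip x) q :=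
    h.hasFDerivAt_apply_const hq.2 x
  have h1 := ((h.hasFDerivAt hq.2).clm_apply h0).hasFDerivWithinAt (s := M)
  -- `R² = R` is known only on `M ∩ U`, so the two derivatives can be compared only within `M`, on
  -- tangent vectors.
  have h2 : HasFDerivWithinAt (fun y => R y (R y x)) ((fderiv ℝ R q).flip x) M q :=
    h0.hasFDerivWithinAt.congr_of_eventuallyEq
      ((h.eventually_mem hq).mono fun y hy => h.apply_apply hy x) (h.apply_apply hq x)
  have h3 := fderivWithin_apply_eq h2 h1 hu
  simpa [add_comm] using h3

/-- In `R' = R' R + R R'` the first term is already all of `R' w` for tangent `w`, so `R'` sends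
tangent vectors to normal ones. The next lemma is the counterpart: `R'` sends normal vectors to
tangent ones. -/
theorem apply_fderiv_of_mem (h : IsProjExtension M U R) (hq : q ∈ M ∩ U)
    (hu : u ∈ tangentSpace M q) (hw : w ∈ tangentSpace M q) : R q (fderiv ℝ R q u w) = 0 := by
  have := h.fderiv_apply hq hu w
  rwa [h.apply_eq_self hq hw, left_eq_add] at this

theorem apply_fderiv_of_apply_eq_zero (h : IsProjExtension M U R) (hq : q ∈ M ∩ U)
    (hu : u ∈ tangentSpace M q) {x : Euc D} (hx : R q x = 0) :
    R q (fderiv ℝ R q u x) = fderiv ℝ R q u x := by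
  have := h.fderiv_apply hq hu x
  rw [hx, map_zero, zero_add] at this
  exact this.symm

theorem ambientDeriv_tangentExtension (h : IsProjExtension M U R) (hq : q ∈ M ∩ U) (v w : Euc D) :
    ambientDeriv M (tangentExtension M v) (tangentExtension M w) q =
      fderiv ℝ R q (R q v) w := by
  have hv : tangentExtension M v q = R q v := by rw [tangentExtension, h.eq_tangentProj q hq]
  rw [h.ambientDeriv_eq hq (hv ▸ h.apply_mem hq v) (Z := fun y => R y w) (fun x hx => by
    rw [tangentExtension, h.eq_tangentProj x hx]) (h.hasFDerivAt_apply_const hq.2 w), hv]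
  simp

/-- The second fundamental form in terms of the projections: `II(v, w) = (1 - R) (D_v R) w`. -/
theorem secondFund_eq (h : IsProjExtension M U R) (hq : q ∈ M ∩ U) (hv : v ∈ tangentSpace M q)
    (w : Euc D) : secondFund M q v w = fderiv ℝ R q v w - R q (fderiv ℝ R q v w) := by
  rw [secondFund, secondFundField, h.ambientDeriv_tangentExtension hq, h.normalProj_eq hq,
    h.apply_eq_self hq hv]

/-- `(∇_v II)(v, w)` in terms of the derivatives of the projections. -/
theorem covDerivSecondFund_eq (h : IsProjExtension M U R) (hq : q ∈ M ∩ U)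
    (hv : v ∈ tangentSpace M q) (hw : w ∈ tangentSpace M q) :
    covDerivSecondFund M q v v w =
      (fderiv ℝ (fderiv ℝ R) q v v w + fderiv ℝ R q (fderiv ℝ R q v v) w) -
        R q (fderiv ℝ (fderiv ℝ R) q v v w + fderiv ℝ R q (fderiv ℝ R q v v) w) := by
  set b := fderiv ℝ (fderiv ℝ R) q v v w + fderiv ℝ R q (fderiv ℝ R q v v) w with hb
  have hvq : tangentExtension M v q = v := by
    rw [tangentExtension, ← h.eq_tangentProj q hq, h.apply_eq_self hq hv]
  have hvT : tangentExtension M v q ∈ tangentSpace M q := hvq.symm ▸ hv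
  have hRv := h.hasFDerivAt_apply_const hq.2 v
  -- The extended field `y ↦ R y v` has derivative `(D_v R) v` in the direction `v`, which is the
  -- source of the second term of `b`.
  obtain ⟨B', hB', hB'v⟩ : ∃ B' : Euc D →L[ℝ] Euc D,
      HasFDerivAt (fun y => fderiv ℝ R y (R y v) w) B' q ∧ B' v = b := by
    refine ⟨_, ((h.hasFDerivAt_fderiv hq.2).clm_apply hRv).clm_apply (hasFDerivAt_const w q), ?_⟩
    simp [hb, h.apply_eq_self hq hv, add_comm]
  obtain ⟨C', hC', hC'v⟩ : ∃ C' : Euc D →L[ℝ] Euc D,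
      HasFDerivAt (fun y => R y (fderiv ℝ R y (R y v) w)) C' q ∧
        C' v = fderiv ℝ R q v (fderiv ℝ R q v w) + R q b := by
    refine ⟨_, (h.hasFDerivAt hq.2).clm_apply hB', ?_⟩
    simp [hB'v, h.apply_eq_self hq hv, add_comm]
  -- `D_v R` is applied twice to a tangent vector: tangent to normal and back to tangent. The result
  -- disappears under the normal projection in `e1` and `e3`.
  have hnn := h.apply_fderiv_of_apply_eq_zero hq hv (h.apply_fderiv_of_mem hq hv hw)
  have e1 : normalConnection M (tangentExtension M v)
      (secondFundField M (tangentExtension M v) (tangentExtension M w)) q = b - R q b := by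
    rw [normalConnection, h.ambientDeriv_eq hq hvT (fun x hx => by
      rw [secondFundField, h.ambientDeriv_tangentExtension hx, h.normalProj_eq hx]; rfl)
      (hB'.sub hC'), hvq, h.normalProj_eq hq]
    simp only [sub_apply, hB'v, hC'v, map_sub, map_add, hnn,
      h.apply_apply hq]
    abel
  -- The tangent extension of `v` is parallel at `q` in the direction `v`, so the differentiation
  -- direction here is zero.
  have e2 : secondFundField M (connection M (tangentExtension M v) (tangentExtension M v))
      (tangentExtension M w) q = 0 := by
    have : connection M (tangentExtension M v) (tangentExtension M v) q = 0 := by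
      rw [connection, h.ambientDeriv_tangentExtension hq, h.apply_eq_self hq hv,
        ← h.eq_tangentProj q hq, h.apply_fderiv_of_mem hq hv hv]
    rw [secondFundField, ambientDeriv, this, map_zero, map_zero]
  -- The inner field vanishes at `q`, but its ambient derivative need not; that derivative, `C' v`,
  -- is tangent, so only its normal part is zero.
  have e3 : secondFundField M (tangentExtension M v)
      (connection M (tangentExtension M v) (tangentExtension M w)) q = 0 := by
    rw [secondFundField, h.ambientDeriv_eq hq hvT (fun x hx => by
      rw [connection, h.ambientDeriv_tangentExtension hx, ← h.eq_tangentProj x hx]) hC', hvq,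
      h.normalProj_eq hq]
    simp [hC'v, hnn, h.apply_apply hq]
  rw [covDerivSecondFund, covDerivSecondFundField, e1, e2, e3, sub_zero, sub_zero]

end IsProjExtension

/-! ### Geodesics -/

theorem uniqueDiffOn_of_ordConnected {J : Set ℝ} (hJ : J.OrdConnected) (hJ' : J.Nontrivial) :
    UniqueDiffOn ℝ J := by
  obtain ⟨a, ha, b, hb, hab⟩ := hJ'.exists_lt
  refine uniqueDiffOn_convex hJ.convex ?_
  exact (nonempty_Ioo.2 hab).mono
    (interior_maximal (Ioo_subset_Icc_self.trans (hJ.out ha hb)) isOpen_Ioo)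

namespace IsUnitSpeedGeodesic

variable {J : Set ℝ} {γ v : ℝ → Euc D} {t : ℝ}

theorem uniqueDiffOn (hγ : IsUnitSpeedGeodesic M J γ) : UniqueDiffOn ℝ J :=
  uniqueDiffOn_of_ordConnected hγ.ordConnected hγ.nontrivial

theorem hasDerivWithinAt (hγ : IsUnitSpeedGeodesic M J γ) (ht : t ∈ J) :
    HasDerivWithinAt γ (derivWithin γ J t) J t :=
  (hγ.smooth.differentiableOn (by simp) t ht).hasDerivWithinAt

theorem hasDerivWithinAt_comp (hγ : IsUnitSpeedGeodesic M J γ) (ht : t ∈ J) {G : Type*}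
    [NormedAddCommGroup G] [NormedSpace ℝ G] {f : Euc D → G} {f' : Euc D →L[ℝ] G}
    (hf : HasFDerivAt f f' (γ t)) :
    HasDerivWithinAt (fun s => f (γ s)) (f' (derivWithin γ J t)) J t :=
  hf.comp_hasDerivWithinAt t (hγ.hasDerivWithinAt ht)

theorem velocity_mem (hM : IsSmoothSubmanifold d M) (hγ : IsUnitSpeedGeodesic M J γ)
    (ht : t ∈ J) : derivWithin γ J t ∈ tangentSpace M (γ t) :=
  hM.velocity_mem_tangentSpace (hγ.hasDerivWithinAt ht) (hγ.uniqueDiffOn t ht) ht hγ.mapsTo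

variable {U : Set (Euc D)} {R : Euc D → Euc D →L[ℝ] Euc D}

/-- The geodesic equation in terms of the projections: `γ'' = (D_{γ'} R) γ'`. -/
theorem hasDerivWithinAt_velocity (hM : IsSmoothSubmanifold d M) (hγ : IsUnitSpeedGeodesic M J γ)
    (h : IsProjExtension M U R) (ht : t ∈ J) (htU : γ t ∈ U) :
    HasDerivWithinAt (derivWithin γ J)
      (fderiv ℝ R (γ t) (derivWithin γ J t) (derivWithin γ J t)) J t := by
  have hd : ContDiffOn ℝ ∞ (derivWithin γ J) J :=
    hγ.smooth.derivWithin hγ.uniqueDiffOn (by simp)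
  have h1 := (hd.differentiableOn (by simp) t ht).hasDerivWithinAt
  have h2 := ((h.hasFDerivAt htU).comp_hasDerivWithinAt t (hγ.hasDerivWithinAt ht)).clm_apply h1
  have h3 : HasDerivWithinAt (fun s => R (γ s) (derivWithin γ J s))
      (derivWithin (derivWithin γ J) J t) J t := by
    refine h1.congr_of_eventuallyEq ?_
      (h.apply_eq_self ⟨hγ.mapsTo ht, htU⟩ (hγ.velocity_mem hM ht))
    filter_upwards [self_mem_nhdsWithin, (hγ.hasDerivWithinAt ht).continuousWithinAt.eventually_mem
      (h.isOpen.mem_nhds htU)] with s hs hsU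
    exact h.apply_eq_self ⟨hγ.mapsTo hs, hsU⟩ (hγ.velocity_mem hM hs)
  -- Differentiating `R γ' = γ'` gives `γ'' = (D_{γ'} R) γ' + R γ''`; the geodesic equation removes
  -- the last term.
  have h4 := (hγ.uniqueDiffOn t ht).eq_deriv J h3 h2
  have h5 : R (γ t) (derivWithin (derivWithin γ J) J t) = 0 := by
    rw [h.eq_tangentProj _ ⟨hγ.mapsTo ht, htU⟩]
    exact hγ.geodesic t ht
  simp only [Function.comp_apply, h5, add_zero] at h4
  rwa [h4] at h1

end IsUnitSpeedGeodesic

/-! ### The operator `II(v, ·)` on the ambient space and its derivative along a geodesic -/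

/-- The operator `(1 - R) (D_v R)`, which restricts on `T_qM` to `II_q(v, ·)`. -/
noncomputable def shapeOp (R : Euc D → Euc D →L[ℝ] Euc D) (q v : Euc D) : Euc D →L[ℝ] Euc D :=
  fderiv ℝ R q v - (R q).comp (fderiv ℝ R q v)

namespace IsProjExtension

variable {U : Set (Euc D)} {R : Euc D → Euc D →L[ℝ] Euc D} {q u v w : Euc D}

theorem shapeOp_apply (h : IsProjExtension M U R) (hq : q ∈ M ∩ U) (hv : v ∈ tangentSpace M q)
    (w : Euc D) : shapeOp R q v w = secondFund M q v w :=
  (h.secondFund_eq hq hv w).symm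

/-- `D_v R` sends a normal vector to a tangent one, which `1 - R` kills. This is what allows a fixed
ambient basis in place of a moving tangent frame. -/
theorem shapeOp_eq_zero (h : IsProjExtension M U R) (hq : q ∈ M ∩ U) (hv : v ∈ tangentSpace M q)
    (hw : w ∈ (tangentSpace M q)ᗮ) : shapeOp R q v w = 0 := by
  have : R q w = 0 := by
    rw [h.eq_tangentProj q hq]
    exact (Submodule.starProjection_apply_eq_zero_iff _).2 hw
  simp [shapeOp, h.apply_fderiv_of_apply_eq_zero hq hv this]

/-- The operator has normal values and `R q` is symmetric, so pairing with it sees only the normal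
part of `x`. -/
theorem inner_shapeOp_eq (h : IsProjExtension M U R) (hq : q ∈ M ∩ U)
    (v w x : Euc D) :
    inner ℝ (shapeOp R q v w) x = inner ℝ (shapeOp R q v w) (x - R q x) := by
  have h1 : R q (shapeOp R q v w) = 0 := by simp [shapeOp, h.apply_apply hq]
  have h2 : inner ℝ (shapeOp R q v w) (R q x) = 0 := by
    rw [h.eq_tangentProj q hq, tangentProj, ← Submodule.inner_starProjection_left_eq_right,
      ← tangentProj, ← h.eq_tangentProj q hq, h1, inner_zero_left]
  rw [inner_sub_right, h2, sub_zero]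

end IsProjExtension

/-- Along a geodesic, the normal part of the derivative of `II(γ', ·)` is `(∇_{γ'} II)(γ', ·)`. -/
theorem IsUnitSpeedGeodesic.exists_hasDerivWithinAt_shapeOp {J : Set ℝ} {γ : ℝ → Euc D} {t : ℝ}
    {U : Set (Euc D)} {R : Euc D → Euc D →L[ℝ] Euc D} (hM : IsSmoothSubmanifold d M)
    (hγ : IsUnitSpeedGeodesic M J γ) (h : IsProjExtension M U R) (ht : t ∈ J) (htU : γ t ∈ U) :
    ∃ A' : Euc D →L[ℝ] Euc D,
      HasDerivWithinAt (fun s => shapeOp R (γ s) (derivWithin γ J s)) A' J t ∧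
      ∀ w ∈ tangentSpace M (γ t), A' w - R (γ t) (A' w) =
        covDerivSecondFund M (γ t) (derivWithin γ J t) (derivWithin γ J t) w := by
  have hq : γ t ∈ M ∩ U := ⟨hγ.mapsTo ht, htU⟩
  have hv := hγ.velocity_mem hM ht
  have h1 := hγ.hasDerivWithinAt_comp (G := Euc D →L[ℝ] Euc D →L[ℝ] Euc D) ht
    (h.hasFDerivAt_fderiv htU)
  have h2 : HasDerivWithinAt (fun s => R (γ s)) (fderiv ℝ R (γ t) (derivWithin γ J t)) J t :=
    hγ.hasDerivWithinAt_comp ht (h.hasFDerivAt htU)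
  -- The second term comes from `γ'' = (D_{γ'} R) γ'`. This agrees with the derivative of the
  -- extension `y ↦ R y v` in the direction `v = γ'`, so `B' w` is exactly the vector whose normal
  -- part is `(∇_v II)(v, w)`.
  obtain ⟨B', hB'⟩ : ∃ B', B' =
      fderiv ℝ (fderiv ℝ R) (γ t) (derivWithin γ J t) (derivWithin γ J t) +
        fderiv ℝ R (γ t) (fderiv ℝ R (γ t) (derivWithin γ J t) (derivWithin γ J t)) :=
    ⟨_, rfl⟩
  have h3 : HasDerivWithinAt (fun s => fderiv ℝ R (γ s) (derivWithin γ J s)) B' J t := by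
    rw [hB']
    exact h1.clm_apply (hγ.hasDerivWithinAt_velocity hM h ht htU)
  have h4 := h3.fun_sub (h2.clm_comp h3)
  refine ⟨_, h4, fun w hw => ?_⟩
  rw [h.covDerivSecondFund_eq hq hv hw]
  have hnn := h.apply_fderiv_of_apply_eq_zero hq hv (h.apply_fderiv_of_mem hq hv hw)
  have hBw : B' w = fderiv ℝ (fderiv ℝ R) (γ t) (derivWithin γ J t) (derivWithin γ J t) w +
      fderiv ℝ R (γ t) (fderiv ℝ R (γ t) (derivWithin γ J t) (derivWithin γ J t)) w := by
    rw [hB']; rfl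
  rw [← hBw]
  simp only [sub_apply, add_apply, ContinuousLinearMap.comp_apply, map_sub, map_add, hnn, h.apply_apply hq]
  abel

/-! ### Hilbert-Schmidt norms and inner products -/

section HilbertSchmidt

variable {E F : Type*} [NormedAddCommGroup E] [InnerProductSpace ℝ E]
  [NormedAddCommGroup F] [InnerProductSpace ℝ F] {ι κ : Type*} [Fintype ι] [Fintype κ]

/-- The Hilbert-Schmidt inner product with an operator that vanishes on `Tᗮ` may be computed in an
orthonormal basis of `T`. -/
theorem sum_inner_eq_sum_inner (T : Submodule ℝ E) [T.HasOrthogonalProjection]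
    (e : OrthonormalBasis κ ℝ T) (b : OrthonormalBasis ι ℝ E) (A B : E →L[ℝ] F)
    (hA : ∀ x ∈ Tᗮ, A x = 0) :
    ∑ i, inner ℝ (A (b i)) (B (b i)) = ∑ j, inner ℝ (A (e j)) (B (e j)) := by
  have hA' : ∀ x, A x = ∑ j, inner ℝ (e j : E) x • A (e j) := by
    intro x
    have h1 : A x = A (T.starProjection x) := by
      rw [← sub_eq_zero, ← map_sub]
      exact hA _ (Submodule.sub_starProjection_mem_orthogonal x)
    rw [h1, OrthonormalBasis.starProjection_eq_sum_rankOne e]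
    simp
  have hB' : ∀ j, B (e j) = ∑ i, inner ℝ (e j : E) (b i) • B (b i) := by
    intro j
    conv_lhs => rw [← b.sum_repr' (e j : E)]
    simp [real_inner_comm]
  -- With `A` expanded in `e` and `B (e j)` in `b`, both sides are the same double sum of `⟨e j, b
  -- i⟩ ⟨A (e j), B (b i)⟩`.
  simp_rw [hB', inner_sum, inner_smul_right]
  rw [Finset.sum_comm]
  refine Finset.sum_congr rfl fun i _ => ?_
  rw [hA' (b i), sum_inner]
  simp_rw [real_inner_smul_left]

end HilbertSchmidt

/-- The Hilbert-Schmidt norm on `T_qM` of `II_q(v, ·)` as a sum over an orthonormal basis of the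
ambient space. -/
theorem IsProjExtension.hsNorm_secondFund {U : Set (Euc D)} {R : Euc D → Euc D →L[ℝ] Euc D}
    {q v : Euc D} (h : IsProjExtension M U R) (hq : q ∈ M ∩ U) (hv : v ∈ tangentSpace M q)
    {ι : Type*} [Fintype ι] (b : OrthonormalBasis ι ℝ (Euc D)) :
    hsNorm (tangentSpace M q) (fun w => secondFund M q v w) =
      √(∑ i, ‖shapeOp R q v (b i)‖ ^ 2) := by
  have := sum_inner_eq_sum_inner (tangentSpace M q) (stdOrthonormalBasis ℝ _) b (shapeOp R q v)
    (shapeOp R q v) fun x hx => h.shapeOp_eq_zero hq hv hx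
  simp_rw [real_inner_self_eq_norm_sq] at this
  rw [hsNorm, this]
  simp_rw [h.shapeOp_apply hq hv]

/-- If the norm were zero, `A` would vanish on an orthonormal basis of `T`, hence at `w`. -/
theorem hsNorm_pos {T : Submodule ℝ (Euc D)} (A : Euc D →L[ℝ] Euc D) {w : Euc D} (hw : w ∈ T)
    (hA : A w ≠ 0) : 0 < hsNorm T A := by
  refine Real.sqrt_pos.2 (lt_of_le_of_ne (Finset.sum_nonneg fun i _ => sq_nonneg _) fun h0 => hA ?_)
  have h1 := (Finset.sum_eq_zero_iff_of_nonneg fun i _ => sq_nonneg _).1 h0.symm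
  have h2 := congrArg (fun x : T => A x) ((stdOrthonormalBasis ℝ T).sum_repr ⟨w, hw⟩)
  simp only [Submodule.coe_sum, map_sum, Submodule.coe_smul, map_smul] at h2
  rw [← h2]
  refine Finset.sum_eq_zero fun i hi => ?_
  have := h1 i hi
  simp only [sq_eq_zero_iff, norm_eq_zero] at this
  rw [this, smul_zero]

theorem abs_sum_inner_le_hsNorm_mul_hsNorm (T : Submodule ℝ (Euc D)) (A B : Euc D → Euc D) :
    |∑ j, inner ℝ (A (stdOrthonormalBasis ℝ T j)) (B (stdOrthonormalBasis ℝ T j))| ≤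
      hsNorm T A * hsNorm T B := by
  refine (Finset.abs_sum_le_sum_abs _ _).trans ((Finset.sum_le_sum fun j _ =>
    abs_real_inner_le_norm _ _).trans ?_)
  exact Real.sum_mul_le_sqrt_mul_sqrt _ _ _

/-! ### The logarithmic derivative -/

/-- The logarithmic derivative of the Hilbert-Schmidt norm of `II(γ', ·)` along a geodesic. -/
theorem IsUnitSpeedGeodesic.exists_hasDerivWithinAt_log_hsNorm (hM : IsSmoothSubmanifold d M)
    {J : Set ℝ} {γ v : ℝ → Euc D} (hγ : IsUnitSpeedGeodesic M J γ)
    (hv : ∀ t ∈ J, v t = derivWithin γ J t) {t : ℝ} (ht : t ∈ J)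
    (hII : ∃ w ∈ tangentSpace M (γ t), secondFund M (γ t) (v t) w ≠ 0) :
    ∃ c, HasDerivWithinAt (fun s => Real.log (hsNorm (tangentSpace M (γ s))
        (fun w => secondFund M (γ s) (v s) w))) c J t ∧
      |c| ≤ hsNorm (tangentSpace M (γ t)) (fun w => covDerivSecondFund M (γ t) (v t) (v t) w) /
        hsNorm (tangentSpace M (γ t)) (fun w => secondFund M (γ t) (v t) w) := by
  obtain ⟨U, R, htU, h⟩ := hM.exists_isProjExtension (hγ.mapsTo ht)
  have hq : γ t ∈ M ∩ U := ⟨hγ.mapsTo ht, htU⟩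
  have hvT : ∀ s ∈ J, v s ∈ tangentSpace M (γ s) := fun s hs => hv s hs ▸ hγ.velocity_mem hM hs
  obtain ⟨A', hA', hcov⟩ := hγ.exists_hasDerivWithinAt_shapeOp hM h ht htU
  set A : ℝ → Euc D →L[ℝ] Euc D := fun s => shapeOp R (γ s) (derivWithin γ J s) with hA
  have hAv : ∀ s ∈ J, A s = shapeOp R (γ s) (v s) := fun s hs => by rw [hA, hv s hs]
  set T := tangentSpace M (γ t)
  set b := EuclideanSpace.basisFun (Fin D) ℝ
  set f : ℝ → ℝ := fun s => ∑ i, ‖A s (b i)‖ ^ 2 with hf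
  have hnorm : ∀ s ∈ J, γ s ∈ U → hsNorm (tangentSpace M (γ s))
      (fun w => secondFund M (γ s) (v s) w) = √(f s) := fun s hs hsU => by
    rw [h.hsNorm_secondFund ⟨hγ.mapsTo hs, hsU⟩ (hvT s hs) b, ← hAv s hs]
  have hAII : (fun w => secondFund M (γ t) (v t) w) = A t := funext fun w => by
    rw [hAv t ht, h.shapeOp_apply hq (hvT t ht)]
  have hf' : HasDerivWithinAt f (∑ i, 2 * inner ℝ (A t (b i)) (A' (b i))) J t := by
    refine HasDerivWithinAt.fun_sum fun i _ => ?_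
    simpa using (hA'.clm_apply (hasDerivWithinAt_const t J (b i))).norm_sq
  have hpos : 0 < √(f t) := by
    obtain ⟨w, hw, hne⟩ := hII
    rw [← hnorm t ht htU, hAII]
    exact hsNorm_pos (A t) hw (by rwa [← congrFun hAII w])
  have hfpos : 0 < f t := Real.sqrt_pos.1 hpos
  -- `A t` kills normal vectors, so the sum reduces to a basis of `T`; `A t` has normal values, so
  -- `A'` may be replaced by its normal part, which is the covariant derivative.
  have hsum : ∑ i, 2 * inner ℝ (A t (b i)) (A' (b i)) =
      2 * ∑ j, inner ℝ (A t (stdOrthonormalBasis ℝ T j))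
        (covDerivSecondFund M (γ t) (v t) (v t) (stdOrthonormalBasis ℝ T j)) := by
    rw [← Finset.mul_sum, sum_inner_eq_sum_inner T (stdOrthonormalBasis ℝ T) b (A t) A'
      fun x hx => by rw [hAv t ht, h.shapeOp_eq_zero hq (hvT t ht) hx]]
    congr 1
    refine Finset.sum_congr rfl fun j _ => ?_
    rw [hv t ht, ← hcov _ (stdOrthonormalBasis ℝ T j).2]
    exact h.inner_shapeOp_eq hq _ _ _
  -- Near `t` in `J` the function is `log √f = (log f) / 2`, so `c = f' / f / 2`. The identity holds
  -- only while `γ s` stays in `U`.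
  refine ⟨_, ((hf'.log hfpos.ne').div_const 2).congr_of_eventuallyEq ?_ ?_, ?_⟩
  · filter_upwards [self_mem_nhdsWithin, (hγ.hasDerivWithinAt ht).continuousWithinAt.eventually_mem
      (h.isOpen.mem_nhds htU)] with s hs hsU
    rw [hnorm s hs hsU, Real.log_sqrt (Finset.sum_nonneg fun i _ => sq_nonneg _)]
  · rw [hnorm t ht htU, Real.log_sqrt hfpos.le]
  · have hle := abs_sum_inner_le_hsNorm_mul_hsNorm T (A t)
      (fun w => covDerivSecondFund M (γ t) (v t) (v t) w)
    have hAt : hsNorm T (A t) = √(f t) := by rw [← hAII, hnorm t ht htU]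
    rw [hAt] at hle
    -- The factor `2` cancels and the claim becomes `|⟨A, ∇II⟩| / f ≤ ‖∇II‖ / √f`, which is
    -- Cauchy-Schwarz because `√f = ‖A‖`.
    rw [hsum, hnorm t ht htU, abs_div, abs_div, abs_mul, abs_two, abs_of_pos hfpos,
      div_div, mul_comm (f t), mul_div_mul_left _ _ two_ne_zero, div_le_div_iff₀ hfpos hpos]
    calc _ ≤ _ := mul_le_mul_of_nonneg_right hle hpos.le
      _ = hsNorm T (fun w => covDerivSecondFund M (γ t) (v t) (v t) w) * (√(f t) * √(f t)) := by
        ring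
      _ = _ := by rw [Real.mul_self_sqrt hfpos.le]

end EuclideanSubmanifold

theorem mainTheorem9 (D d : ℕ) (M : Set (EuclideanSubmanifold.Euc D))
    (hM : EuclideanSubmanifold.IsSmoothSubmanifold d M)
    (J : Set ℝ) (γ v : ℝ → EuclideanSubmanifold.Euc D)
    (hγ : EuclideanSubmanifold.IsUnitSpeedGeodesic M J γ)
    (hv : ∀ t ∈ J, v t = derivWithin γ J t)
    (hII : ∀ t ∈ J, ∃ w ∈ EuclideanSubmanifold.tangentSpace M (γ t),
      EuclideanSubmanifold.secondFund M (γ t) (v t) w ≠ 0) :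
    ∀ t ∈ J,
      DifferentiableWithinAt ℝ
        (fun s => Real.log
          (EuclideanSubmanifold.hsNorm (EuclideanSubmanifold.tangentSpace M (γ s))
            (fun w => EuclideanSubmanifold.secondFund M (γ s) (v s) w))) J t ∧
      |derivWithin
        (fun s => Real.log
          (EuclideanSubmanifold.hsNorm (EuclideanSubmanifold.tangentSpace M (γ s))
            (fun w => EuclideanSubmanifold.secondFund M (γ s) (v s) w))) J t| ≤
        EuclideanSubmanifold.hsNorm (EuclideanSubmanifold.tangentSpace M (γ t))
            (fun w => EuclideanSubmanifold.covDerivSecondFund M (γ t) (v t) (v t) w) /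
          EuclideanSubmanifold.hsNorm (EuclideanSubmanifold.tangentSpace M (γ t))
            (fun w => EuclideanSubmanifold.secondFund M (γ t) (v t) w) := by
  intro t ht
  obtain ⟨c, hc, hle⟩ := hγ.exists_hasDerivWithinAt_log_hsNorm hM hv ht (hII t ht)
  exact ⟨hc.differentiableWithinAt, (hc.derivWithin (hγ.uniqueDiffOn t ht)).symm ▸ hle⟩
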